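/- **Theorem 4 (Regret bound for CCB($\varepsilon,\delta$)).** *Setting.* Let $\mathcal Y\subseteq\mathbb R$ be a context space, $\mathcal X$ a set of arm states, and let there be $K\ge 1$ arms. In each trial $t=1,2,\dots$ a pair $(y_t,x_t)$ is drawn, independently and identically distributed over the trials, where $y_t\in\mathcal Y$ is the context and $x_t=(x_{1,t},\dots,x_{K,t})\in\mathcal X^K$ is the vector of arm states, independent of $y_t$. The agent sees $y_t$, pulls an arm $a_t\in\{1,\dots,K\}$ that depends on $y_t$ and on the past contexts, pulls and observed states, receives the reward $g(y_t,x_{a_t,t})$, and observes $x_{a_t,t}$ only. The function $g:\mathcal Y\times\mathcal X\to\mathbb R$ is known, bounded ($|g|\le B$) and $L$-Lipschitz in the context with $L\ge 0$: $|g(y,x)-g(y',x)|\le L|y-y'|$ for all $y,y'\in\mathcal Y$, $x\in\mathcal X$. Let $R(h)=\mathbb E[g(y_1,x_{h(y_1),1})]$ for $h:\mathcal Y\to\{1,\dots,K\}$, and let $h^*$ be a Bayes optimal hypothesis, i.e. a maximizer of $R$. The expected regret over the horizon $T$ is $$\mathfrak R(T)=T\,R(h^*)-\mathbb E\Big[\sum_{t=1}^{T}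 g(y_t,x_{a_t,t})\Big].$$ *Algorithm.* Let $\varepsilon,\delta>0$. Partition $\mathcal Y$ into finitely many intervals $I_1,\dots,I_M$ of size $\delta$ (intervals may be shorter where $\mathcal Y$ does not split evenly), and let $c_i\in I_i$ be the center point of $I_i$. In the trials $n=1,\dots,K$ the arm $n$ is pulled. In a trial $n>K$ with $y_n\in I_i$, CCB($\varepsilon,\delta$) pulls an arm $j$ that maximizes $$\hat\theta_{i,j}+G_i\sqrt{\frac{(2+\varepsilon)\ln n}{m_j}},\qquad G_i=\sup_{x\in\mathcal X}g(c_i,x)-\inf_{x\in\mathcal X}g(c_i,x),$$ where $m_j$ is the number of previous pulls of the arm $j$ and $\hat\theta_{i,j}$ is the mean of $g(c_i,\cdot)$ over the states of the arm $j$ observed in all these pulls; ties are broken by any rule that uses only what the agent has observed so far. (This is the discrete algorithm DCB($\varepsilon$) with context set $\{c_1,\dots,c_M\}$, run on the quantized contexts.) *Claim.* The expected regret of CCB($\varepsilon,\delta$) is at most $\delta LT+O(\log T)$: there is a constant $C$, which may depend on $g$, on the distributions of the contexts and of the arm states, on $\varepsilon$, on $\delta$ and on the partition, but neither on $T$ nor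 on the tie-breaking rule, such that for all $T\ge 2$ $$\mathfrak R(T)\le \delta L T+C\log T .$$ -/

import Mathlib

open MeasureTheory ProbabilityTheory

noncomputable section

namespace CCB

/-! ### The discrete algorithm DCB(ε)

DCB(ε) works with finitely many contexts `i : Fin M`, arms `j : Fin K`, arm states in `X`, and
the known reward `r i x` of a state `x` under the context `i`.  After `n` trials its data are the
pairs (pulled arm, observed state), `h : Fin n → Fin K × X`. -/

section DCB

variable {X : Type*} {K M n : ℕ}

/-- The number `m_j` of earlier pulls of the arm `j`. -/
def pulls (h : Fin n → Fin K × X) (j : Fin K) : ℕ :=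
  (Finset.univ.filter fun s => (h s).1 = j).card

/-- The sample mean `θ̂_{i,j}` of the rewards that the observed states of the arm `j` would have
given under the context `i` (every pull is used for every context). -/
def sampleMean (r : Fin M → X → ℝ) (h : Fin n → Fin K × X) (i : Fin M) (j : Fin K) : ℝ :=
  (∑ s ∈ Finset.univ.filter (fun s => (h s).1 = j), r i (h s).2) / pulls h j

/-- The maximal deviation `G_i` of the rewards under the context `i`. -/
def rewardRange (r : Fin M → X → ℝ) (i : Fin M) : ℝ :=
  (⨆ x, r i x) - ⨅ x, r i x

/-- The upper confidence bound of the arm `j` under the context `i` in trial number `n + 1`. -/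
def ucbIndex (ε : ℝ) (r : Fin M → X → ℝ) (h : Fin n → Fin K × X) (i : Fin M) (j : Fin K) : ℝ :=
  sampleMean r h i j +
    rewardRange r i * Real.sqrt ((2 + ε) * Real.log ((n : ℝ) + 1) / (pulls h j : ℝ))

/-- In trial number `n + 1`, with context `i` and data `h` of the first `n` trials, DCB(ε) may
pull the arm `a`: the arms are pulled once each in the first `K` trials, and afterwards `a` has to
maximize the upper confidence bound (ties may be broken in any way). -/
def IsDCBChoice (ε : ℝ) (r : Fin M → X → ℝ) (h : Fin n → Fin K × X) (i : Fin M)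
    (a : Fin K) : Prop :=
  if n < K then (a : ℕ) = n else ∀ j : Fin K, ucbIndex ε r h i j ≤ ucbIndex ε r h i a

end DCB

/-! ### Quantization of the context space -/

/-- A partition of the context space `Y` into `M` intervals of size `δ` (an interval may be
shorter than `δ`, since the length of `Y` need not be a multiple of `δ`). -/
structure IntervalPartition (Y : Set ℝ) (δ : ℝ) (M : ℕ) where
  cell : Fin M → Set ℝ
  nonempty : ∀ i, (cell i).Nonempty
  ordConnected : ∀ i, (cell i).OrdConnected
  size_le : ∀ i, ∀ y ∈ cell i, ∀ y' ∈ cell i, |y - y'| ≤ δ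
  disjoint : ∀ i j, i ≠ j → Disjoint (cell i) (cell j)
  iUnion_eq : ⋃ i, cell i = Y

namespace IntervalPartition

variable {Y : Set ℝ} {δ : ℝ} {M : ℕ} (Q : IntervalPartition Y δ M)

/-- The midpoint of the `i`-th interval, as a real number. -/
def midpoint (i : Fin M) : ℝ := (sInf (Q.cell i) + sSup (Q.cell i)) / 2

theorem midpoint_mem_cell (i : Fin M) : Q.midpoint i ∈ Q.cell i := by
  obtain ⟨y, hy⟩ := Q.nonempty i
  have hA : BddAbove (Q.cell i) :=
    ⟨y + δ, fun z hz => by have := (abs_le.1 (Q.size_le i z hz y hy)).2; linarith⟩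
  have hB : BddBelow (Q.cell i) :=
    ⟨y - δ, fun z hz => by have := (abs_le.1 (Q.size_le i z hz y hy)).1; linarith⟩
  have h1 := csInf_le hB hy
  have h2 := le_csSup hA hy
  rcases (h1.trans h2).eq_or_lt with h | h
  · have : Q.midpoint i = y := by unfold midpoint; linarith
    rwa [this]
  · have ha : sInf (Q.cell i) < Q.midpoint i := by unfold midpoint; linarith
    have hb : Q.midpoint i < sSup (Q.cell i) := by unfold midpoint; linarith
    obtain ⟨u, hu, hu'⟩ := exists_lt_of_csInf_lt ⟨y, hy⟩ ha
    obtain ⟨v, hv, hv'⟩ := exists_lt_of_lt_csSup ⟨y, hy⟩ hb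
    exact (Q.ordConnected i).out hu hv ⟨hu'.le, hv'.le⟩

/-- The center point of the `i`-th interval, as a context. -/
def center (i : Fin M) : Y :=
  ⟨Q.midpoint i, Q.iUnion_eq.subset (Set.mem_iUnion.2 ⟨i, Q.midpoint_mem_cell i⟩)⟩

theorem exists_mem_cell (y : Y) : ∃ i, (y : ℝ) ∈ Q.cell i :=
  Set.mem_iUnion.1 (Q.iUnion_eq.symm.subset y.2)

/-- The (unique) interval that contains the context `y`. -/
def quantize (y : Y) : Fin M := (Q.exists_mem_cell y).choose

theorem mem_cell_quantize (y : Y) : (y : ℝ) ∈ Q.cell (Q.quantize y) :=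
  (Q.exists_mem_cell y).choose_spec

end IntervalPartition

/-! ### Contextual bandit policies and CCB(ε, δ) -/

section Bandit

variable {Y : Set ℝ} {X : Type*} {K M : ℕ}

/-- A contextual bandit policy: `π n h y` is the arm chosen in trial number `n + 1` when the
current context is `y` and `h` lists the contexts, the pulled arms and the observed states of the
pulled arms in the first `n` trials. -/
abbrev Policy (Y : Set ℝ) (X : Type*) (K : ℕ) : Type _ :=
  (n : ℕ) → (Fin n → Y × Fin K × X) → Y → Fin K

/-- The policy is measurable in the history and the current context. -/
def Policy.IsMeasurable [MeasurableSpace X] (π : Policy Y X K) : Prop :=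
  ∀ n : ℕ, Measurable fun p : (Fin n → Y × Fin K × X) × Y => π n p.1 p.2

/-- The policy `π` is CCB(ε, δ) for the partition `Q`: DCB(ε) is run on the center points of the
intervals, and the current context is fed to it after quantization. -/
def IsCCB {δ : ℝ} (ε : ℝ) (g : Y → X → ℝ) (Q : IntervalPartition Y δ M)
    (π : Policy Y X K) : Prop :=
  ∀ (n : ℕ) (h : Fin n → Y × Fin K × X) (y : Y),
    IsDCBChoice ε (fun i x => g (Q.center i) x) (fun s => (h s).2) (Q.quantize y) (π n h y)

/-- The arm pulled in trial number `t + 1` by `π` on the sequence `z` of contexts and arm-state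
vectors; only the state of the pulled arm is revealed to the policy. -/
def arm (π : Policy Y X K) (z : ℕ → Y × (Fin K → X)) (t : ℕ) : Fin K :=
  π t (fun s : Fin t => ((z s).1, arm π z s, (z s).2 (arm π z s))) (z t).1
termination_by t
decreasing_by all_goals exact s.2

variable [MeasurableSpace X]

/-- The expected reward `R(h)` of the hypothesis `h`, for the law `D` of (context, arm states). -/
def expectedReward (g : Y → X → ℝ) (D : Measure (Y × (Fin K → X))) (h : Y → Fin K) : ℝ :=
  ∫ z, g z.1 (z.2 (h z.1)) ∂D

/-- A Bayes optimal hypothesis: it has the maximal expected reward among all (measurable)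
hypotheses. -/
def IsBayesOptimal (g : Y → X → ℝ) (D : Measure (Y × (Fin K → X))) (h : Y → Fin K) : Prop :=
  Measurable h ∧ ∀ h' : Y → Fin K, Measurable h' → expectedReward g D h' ≤ expectedReward g D h

/-- The expected regret after `n` trials of the policy `π` against the hypothesis `hstar`, on the
random sequence `Z` of contexts and arm-state vectors, `D` being the law of one trial. -/
def regret {Ω : Type*} [MeasurableSpace Ω] (g : Y → X → ℝ) (D : Measure (Y × (Fin K → X)))
    (hstar : Y → Fin K) (P : Measure Ω) (Z : ℕ → Ω → Y × (Fin K → X)) (π : Policy Y X K)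
    (n : ℕ) : ℝ :=
  n * expectedReward g D hstar -
    ∫ ω, ∑ t ∈ Finset.range n, g (Z t ω).1 ((Z t ω).2 (arm π (fun s => Z s ω) t)) ∂P

end Bandit

end CCB

end

namespace CCB

/-! ### Causality and measurability of the pulled arms and their statistics -/

section Arm

variable {Y : Set ℝ} {X : Type*} {K : ℕ}

/-! Quantization changes every reward by at most `L * (δ / 2)`, since a point of a cell lies within
`δ / 2` of the midpoint. This error is paid twice per trial, once for the comparison hypothesis and
once for the policy, which gives the term `δ * L * T` (`regret_le_sum_gap`). What remains is the
regret of DCB(ε) on the finitely many centers, the expected sum of the `gap`s of the pulled arms,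
and it has to be shown logarithmic (`RunsDCB.integral_sum_gap_le`).

For that sum the usual UCB argument applies. After the initial trials, a pull of an arm with
positive gap means that some sample mean misses its confidence interval or that the pulled arm has
been pulled only O(log t) times (`RunsDCB.confidenceFails_or_few_pulls`). Because a pull informs
every context, the second case is counted with one pull counter per arm, and each pair of a center
and an arm contributes O(log T) such pulls (`card_pulls_of_few_le`). The failure probabilities in
trial `t + 1` are at most `2 / (t + 1) ^ 2`, hence summable.

The probabilistic difficulty is that the arms are chosen adaptively, so the observed states of an
arm are not a sample of predetermined size. The pulled arm depends only on the past and the current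
context, both independent of the current state vector, so this vector can be integrated out
(`integral_integrate_out_states`). Hoeffding's exponential process is therefore a supermartingale
along the trials (`integral_exp_armSum_le`), and a union bound over the number of pulls yields the
tail estimate `measureReal_armSum_ge_le`. -/

theorem arm_eq (π : Policy Y X K) (z : ℕ → Y × (Fin K → X)) (t : ℕ) :
    arm π z t =
      π t (fun s : Fin t => ((z s).1, arm π z s, (z s).2 (arm π z s))) (z t).1 := by
  rw [arm]

/-- Causality: the current state vector does not influence the current pull. This is what permits
integrating that vector out. -/
theorem arm_congr (π : Policy Y X K) {z z' : ℕ → Y × (Fin K → X)} (t : ℕ)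
    (h : ∀ s < t, z s = z' s) (ht : (z t).1 = (z' t).1) : arm π z t = arm π z' t := by
  induction t using Nat.strong_induction_on with
  | _ t ih =>
    rw [arm_eq, arm_eq, ht]
    congr 1
    funext s
    have hs : z s = z' s := h s s.2
    have ha : arm π z s = arm π z' s :=
      ih s s.2 (fun u hu => h u (hu.trans s.2)) (congrArg Prod.fst hs)
    rw [hs, ha]

/-- The number of pulls of the arm `j` in the first `t` trials. -/
def armCount (π : Policy Y X K) (z : ℕ → Y × (Fin K → X)) (j : Fin K) (t : ℕ) : ℕ :=
  ∑ u ∈ Finset.range t, if arm π z u = j then 1 else 0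

/-- The sum of `f` over the states of the arm `j` observed in the first `t` trials. -/
noncomputable def armSum (π : Policy Y X K) (f : X → ℝ) (z : ℕ → Y × (Fin K → X)) (j : Fin K)
    (t : ℕ) : ℝ :=
  ∑ u ∈ Finset.range t, if arm π z u = j then f ((z u).2 j) else 0

theorem armCount_congr (π : Policy Y X K) {z z' : ℕ → Y × (Fin K → X)} (j : Fin K) (t : ℕ)
    (h : ∀ s < t, z s = z' s) : armCount π z j t = armCount π z' j t := by
  refine Finset.sum_congr rfl fun u hu => ?_
  have hu := Finset.mem_range.1 hu
  rw [arm_congr π u (fun s hs => h s (hs.trans hu)) (congrArg Prod.fst (h u hu))]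

theorem armSum_congr (π : Policy Y X K) (f : X → ℝ) {z z' : ℕ → Y × (Fin K → X)} (j : Fin K)
    (t : ℕ) (h : ∀ s < t, z s = z' s) : armSum π f z j t = armSum π f z' j t := by
  refine Finset.sum_congr rfl fun u hu => ?_
  have hu := Finset.mem_range.1 hu
  rw [arm_congr π u (fun s hs => h s (hs.trans hu)) (congrArg Prod.fst (h u hu)), h u hu]

theorem armCount_le (π : Policy Y X K) (z : ℕ → Y × (Fin K → X)) (j : Fin K) (t : ℕ) :
    armCount π z j t ≤ t := by
  unfold armCount
  calc _ ≤ ∑ u ∈ Finset.range t, 1 := Finset.sum_le_sum fun u _ => by split_ifs <;> simp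
    _ = t := by simp

theorem abs_armSum_le (π : Policy Y X K) {f : X → ℝ} {A : ℝ} (hA : ∀ x, |f x| ≤ A)
    (z : ℕ → Y × (Fin K → X)) (j : Fin K) (t : ℕ) : |armSum π f z j t| ≤ t * A := by
  unfold armSum
  refine (Finset.abs_sum_le_sum_abs _ _).trans ?_
  have hA0 : 0 ≤ A := (abs_nonneg _).trans (hA ((z 0).2 j))
  calc _ ≤ ∑ u ∈ Finset.range t, A := Finset.sum_le_sum fun u _ => by
        split_ifs
        · exact hA _
        · simpa using hA0
    _ = t * A := by simp

theorem armSum_neg (π : Policy Y X K) (f : X → ℝ) (z : ℕ → Y × (Fin K → X)) (j : Fin K) (t : ℕ) :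
    armSum π (fun x => -f x) z j t = -armSum π f z j t := by
  unfold armSum
  rw [← Finset.sum_neg_distrib]
  exact Finset.sum_congr rfl fun u _ => by split_ifs <;> simp

theorem armSum_sub_const (π : Policy Y X K) (f : X → ℝ) (c : ℝ) (z : ℕ → Y × (Fin K → X))
    (j : Fin K) (t : ℕ) :
    armSum π (fun x => f x - c) z j t = armSum π f z j t - armCount π z j t * c := by
  unfold armSum armCount
  push_cast
  rw [Finset.sum_mul, ← Finset.sum_sub_distrib]
  exact Finset.sum_congr rfl fun u _ => by split_ifs <;> simp

/-- Every counted pull raises the pull counter, and once the counter reaches `b` no further pull is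
counted. -/
theorem card_pulls_of_few_le (π : Policy Y X K) (z : ℕ → Y × (Fin K → X)) (j : Fin K) {b : ℝ}
    (hb : 0 ≤ b) (T : ℕ) :
    ∑ t ∈ Finset.range T, (if arm π z t = j ∧ (armCount π z j t : ℝ) < b then (1 : ℝ) else 0)
      ≤ b + 1 := by
  -- The induction needs the first bound as well: just before a counted pull, the number counted so
  -- far is at most the counter, hence below `b`.
  suffices h : ∑ t ∈ Finset.range T,
      (if arm π z t = j ∧ (armCount π z j t : ℝ) < b then (1 : ℝ) else 0) ≤ armCount π z j T ∧
      ∑ t ∈ Finset.range T,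
      (if arm π z t = j ∧ (armCount π z j t : ℝ) < b then (1 : ℝ) else 0) ≤ b + 1 from h.2
  induction T with
  | zero => simp [armCount]; positivity
  | succ T ih =>
    have hs : (armCount π z j (T + 1) : ℝ)
        = armCount π z j T + if arm π z T = j then (1 : ℝ) else 0 := by
      rw [armCount, Finset.sum_range_succ]
      push_cast [armCount]
      rfl
    rw [Finset.sum_range_succ, hs]
    obtain ⟨h1, h2⟩ := ih
    split_ifs with ha hb' hb'
    · exact ⟨by linarith, by linarith [ha.2]⟩
    · exact absurd ha.1 hb'
    · exact ⟨by linarith, by linarith⟩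
    · exact ⟨by linarith, by linarith⟩

variable [MeasurableSpace X]

theorem measurable_eval_arm :
    Measurable fun p : (Fin K → X) × Fin K => p.1 p.2 :=
  measurable_from_prod_countable_left fun j => measurable_pi_apply j

theorem measurable_arm {π : Policy Y X K} (hπ : π.IsMeasurable) (t : ℕ) :
    Measurable fun z : ℕ → Y × (Fin K → X) => arm π z t := by
  induction t using Nat.strong_induction_on with
  | _ t ih =>
    simp_rw [arm_eq π _ t]
    refine (hπ t).comp (Measurable.prodMk (measurable_pi_lambda _ fun s => ?_) (by fun_prop))
    have ha := ih s s.2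
    refine Measurable.prodMk (by fun_prop) (ha.prodMk ?_)
    exact measurable_eval_arm.comp (Measurable.prodMk (by fun_prop) ha)

theorem measurable_armCount {π : Policy Y X K} (hπ : π.IsMeasurable) (j : Fin K) (t : ℕ) :
    Measurable fun z : ℕ → Y × (Fin K → X) => armCount π z j t := by
  unfold armCount
  refine Finset.measurable_fun_sum _ fun u _ => ?_
  exact Measurable.ite (measurable_arm hπ u (measurableSet_singleton j)) measurable_const
    measurable_const

theorem measurable_armSum {π : Policy Y X K} (hπ : π.IsMeasurable) {f : X → ℝ}
    (hf : Measurable f) (j : Fin K) (t : ℕ) :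
    Measurable fun z : ℕ → Y × (Fin K → X) => armSum π f z j t := by
  unfold armSum
  refine Finset.measurable_fun_sum _ fun u _ => ?_
  exact Measurable.ite (measurable_arm hπ u (measurableSet_singleton j)) (by fun_prop)
    measurable_const

end Arm

/-! ### Integrating out the current state vector -/

section Independence

variable {Ω : Type*} [MeasurableSpace Ω] {P : Measure Ω} [IsProbabilityMeasure P]
  {X : Type*} [MeasurableSpace X] {Y : Set ℝ} {K : ℕ}
  {ν : Measure Y} [IsProbabilityMeasure ν] {ρ : Measure (Fin K → X)} [IsProbabilityMeasure ρ]
  {Z : ℕ → Ω → Y × (Fin K → X)}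

/-- The law of the past trials together with the current context and the current state vector. -/
theorem map_past_context_states (hZ_meas : ∀ t, Measurable (Z t)) (hZ_indep : iIndepFun Z P)
    (hZ_law : ∀ t, P.map (Z t) = ν.prod ρ) (t : ℕ) :
    P.map (fun ω => (((fun s : Finset.range t => Z s ω), (Z t ω).1), (Z t ω).2)) =
      (P.map fun ω => ((fun s : Finset.range t => Z s ω), (Z t ω).1)).prod ρ := by
  have hpast : Measurable fun ω => (fun s : Finset.range t => Z s ω) :=
    measurable_pi_lambda _ fun s => hZ_meas s
  have hind : IndepFun (fun ω => (fun s : Finset.range t => Z s ω)) (Z t) P := by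
    have h := hZ_indep.indepFun_finset (Finset.range t) {t} (by simp) hZ_meas
    exact h.comp (φ := id) (ψ := fun w : (({t} : Finset ℕ) → Y × (Fin K → X)) =>
      w ⟨t, Finset.mem_singleton_self t⟩) measurable_id (measurable_pi_apply _)
  have h1 := (indepFun_iff_map_prod_eq_prod_map_map hpast.aemeasurable
    (hZ_meas t).aemeasurable).1 hind
  rw [hZ_law] at h1
  have := Measure.isProbabilityMeasure_map (μ := P) hpast.aemeasurable
  set W := P.map fun ω => (fun s : Finset.range t => Z s ω) with hW
  have hmeas : Measurable fun ω => ((fun s : Finset.range t => Z s ω), Z t ω) :=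
    hpast.prodMk (hZ_meas t)
  -- Independence of context and states enters here: the law of past and current trial, `W ⊗ (ν ⊗
  -- ρ)`, is regrouped as `(W ⊗ ν) ⊗ ρ`.
  have h2 : P.map (fun ω => (((fun s : Finset.range t => Z s ω), (Z t ω).1), (Z t ω).2))
      = (W.prod ν).prod ρ := by
    rw [← (measurePreserving_prodAssoc W ν ρ).symm.map_eq, ← h1,
      Measure.map_map (MeasurableEquiv.measurable _) hmeas]
    rfl
  have h3 : P.map (fun ω => ((fun s : Finset.range t => Z s ω), (Z t ω).1)) = W.prod ν := by
    have := congrArg (Measure.map Prod.fst) h2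
    rw [Measure.map_map measurable_fst
      ((hpast.prodMk (hZ_meas t).fst).prodMk (hZ_meas t).snd)] at this
    rw [Measure.map_fst_prod] at this
    simpa [Function.comp_def] using this
  rw [h2, h3]

/-- Given the past and the current context, the current state vector can be integrated out. -/
theorem integral_integrate_out_states (hZ_meas : ∀ t, Measurable (Z t)) (hZ_indep : iIndepFun Z P)
    (hZ_law : ∀ t, P.map (Z t) = ν.prod ρ) (t : ℕ)
    {φ : (ℕ → Y × (Fin K → X)) → (Fin K → X) → ℝ}
    (hφ : Measurable fun p : (ℕ → Y × (Fin K → X)) × (Fin K → X) => φ p.1 p.2)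
    {A : ℝ} (hA : ∀ z x, |φ z x| ≤ A)
    (hdep : ∀ z z' : ℕ → Y × (Fin K → X), (∀ s < t, z s = z' s) → (z t).1 = (z' t).1 →
      φ z = φ z') :
    ∫ ω, φ (fun s => Z s ω) (Z t ω).2 ∂P = ∫ ω, ∫ x, φ (fun s => Z s ω) x ∂ρ ∂P := by
  obtain ⟨ω₀⟩ : Nonempty Ω := P.nonempty_of_neZero
  set z₀ := Z t ω₀
  -- Completes the past and the current context to a full sequence. The filler state `z₀.2` and the
  -- entries after trial `t` are arbitrary, because `hdep` makes `φ` blind to them.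
  let ext : ((Finset.range t → Y × (Fin K → X)) × Y) → ℕ → Y × (Fin K → X) := fun u s =>
    if h : s ∈ Finset.range t then u.1 ⟨s, h⟩ else (u.2, z₀.2)
  have hext : Measurable ext := by
    refine measurable_pi_lambda _ fun s => ?_
    by_cases h : s ∈ Finset.range t
    · simp only [ext, h, dite_true]; fun_prop
    · simp only [ext, h, dite_false]; fun_prop
  let U : Ω → (Finset.range t → Y × (Fin K → X)) × Y :=
    fun ω => ((fun s : Finset.range t => Z s ω), (Z t ω).1)
  have hpast : Measurable fun ω => (fun s : Finset.range t => Z s ω) :=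
    measurable_pi_lambda _ fun s => hZ_meas s
  have hU : Measurable U := hpast.prodMk (hZ_meas t).fst
  have hφU : ∀ ω, φ (fun s => Z s ω) = φ (ext (U ω)) := fun ω =>
    hdep _ _ (fun s hs => by simp [ext, U, hs]) (by simp [ext, U])
  simp_rw [hφU]
  let F : ((Finset.range t → Y × (Fin K → X)) × Y) × (Fin K → X) → ℝ :=
    fun p => φ (ext p.1) p.2
  have hF : Measurable F := hφ.comp ((hext.comp measurable_fst).prodMk measurable_snd)
  have := Measure.isProbabilityMeasure_map (μ := P) hU.aemeasurable
  have hFint : Integrable F ((P.map U).prod ρ) :=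
    Integrable.of_bound hF.aestronglyMeasurable A (Filter.Eventually.of_forall fun p => hA _ _)
  have hlaw := map_past_context_states hZ_meas hZ_indep hZ_law t
  calc ∫ ω, φ (ext (U ω)) (Z t ω).2 ∂P
      = ∫ p, F p ∂(P.map fun ω => (U ω, (Z t ω).2)) :=
        (integral_map (hU.prodMk (hZ_meas t).snd).aemeasurable hF.aestronglyMeasurable).symm
    _ = ∫ p, F p ∂((P.map U).prod ρ) := by rw [hlaw]
    _ = ∫ u, ∫ x, F (u, x) ∂ρ ∂(P.map U) := integral_prod _ hFint
    _ = ∫ ω, ∫ x, φ (ext (U ω)) x ∂ρ ∂P :=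
        integral_map hU.aemeasurable
          (hF.stronglyMeasurable.integral_prod_right').aestronglyMeasurable

end Independence

/-! ### Hoeffding's inequality under adaptive sampling -/

section Concentration

variable {Ω : Type*} [MeasurableSpace Ω] {P : Measure Ω} [IsProbabilityMeasure P]
  {X : Type*} [MeasurableSpace X] {Y : Set ℝ} {K : ℕ}
  {ν : Measure Y} [IsProbabilityMeasure ν] {ρ : Measure (Fin K → X)} [IsProbabilityMeasure ρ]
  {Z : ℕ → Ω → Y × (Fin K → X)} {π : Policy Y X K} {f : X → ℝ} {a b : ℝ} {j : Fin K}

/-- Hoeffding's exponential process of the arm `j` has expectation at most one, however the arms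
are chosen. -/
theorem integral_exp_armSum_le (hZ_meas : ∀ t, Measurable (Z t)) (hZ_indep : iIndepFun Z P)
    (hZ_law : ∀ t, P.map (Z t) = ν.prod ρ) (hπ : π.IsMeasurable) (hf : Measurable f)
    (hfab : ∀ x, f x ∈ Set.Icc a b) (hf0 : ∫ x, f (x j) ∂ρ = 0) (l : ℝ) (t : ℕ) :
    ∫ ω, Real.exp (l * armSum π f (fun s => Z s ω) j t
      - armCount π (fun s => Z s ω) j t * (l ^ 2 * (b - a) ^ 2 / 8)) ∂P ≤ 1 := by
  set c := l ^ 2 * (b - a) ^ 2 / 8 with hc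
  have hc0 : 0 ≤ c := by positivity
  set A := max |a| |b|
  have hA : ∀ x, |f x| ≤ A := fun x => abs_le_max_abs_abs (hfab x).1 (hfab x).2
  let E : ℕ → (ℕ → Y × (Fin K → X)) → ℝ := fun t z =>
    Real.exp (l * armSum π f z j t - armCount π z j t * c)
  have hEm : ∀ t, Measurable (E t) := fun t => by
    have h1 := measurable_armSum hπ hf j t
    have h2 := measurable_armCount hπ j t
    have h3 : Measurable fun z : ℕ → Y × (Fin K → X) => (armCount π z j t : ℝ) :=
      measurable_from_top.comp h2
    fun_prop
  have hE0 : ∀ t z, 0 < E t z := fun t z => Real.exp_pos _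
  have hEb : ∀ t z, E t z ≤ Real.exp (|l| * (t * A)) := fun t z => by
    refine Real.exp_le_exp.2 ?_
    have h1 : l * armSum π f z j t ≤ |l| * (t * A) :=
      (le_abs_self _).trans ((abs_mul _ _).trans_le
        (mul_le_mul_of_nonneg_left (abs_armSum_le π hA z j t) (abs_nonneg l)))
    have h2 : 0 ≤ (armCount π z j t : ℝ) * c := by positivity
    linarith
  have hZm : Measurable fun ω => (fun s => Z s ω) := measurable_pi_lambda _ hZ_meas
  have hEint : ∀ t, Integrable (fun ω => E t (fun s => Z s ω)) P := fun t =>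
    Integrable.of_bound ((hEm t).comp hZm).aestronglyMeasurable (Real.exp (|l| * (t * A)))
      (Filter.Eventually.of_forall fun ω => by
        rw [Real.norm_eq_abs, abs_of_pos (hE0 _ _)]; exact hEb _ _)
  change ∫ ω, E t (fun s => Z s ω) ∂P ≤ 1
  -- Hoeffding's lemma for a centered variable in `[a, b]`; the compensator `c` is exactly its
  -- exponent.
  have hoeff : ∫ x, Real.exp (l * f (x j) - c) ∂ρ ≤ 1 := by
    have hsub := hasSubgaussianMGF_of_mem_Icc_of_integral_eq_zero (μ := ρ)
      (X := fun x : Fin K → X => f (x j)) (a := a) (b := b)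
      (hf.comp (measurable_pi_apply j)).aemeasurable
      (Filter.Eventually.of_forall fun x => hfab _) hf0
    have h := hsub.mgf_le l
    rw [mgf] at h
    simp_rw [sub_eq_add_neg, Real.exp_add]
    rw [integral_mul_const]
    refine (mul_le_mul_of_nonneg_right h (Real.exp_pos _).le).trans ?_
    rw [← Real.exp_add, Real.exp_le_one_iff]
    push_cast
    rw [Real.norm_eq_abs, div_pow, sq_abs, hc]
    apply le_of_eq
    ring
  induction t with
  | zero => simp [E, armSum, armCount]
  | succ t ih =>
    refine le_trans ?_ ih
    -- One more trial multiplies the process by the compensated exponential if `j` is pulled and by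
    -- 1 otherwise. Either factor has mean at most 1 over a fresh state vector.
    let φ : (ℕ → Y × (Fin K → X)) → (Fin K → X) → ℝ := fun z x =>
      E t z * if arm π z t = j then Real.exp (l * f (x j) - c) else 1
    have hstep : ∀ z : ℕ → Y × (Fin K → X), E (t + 1) z = φ z (z t).2 := fun z => by
      simp only [E, φ]
      rw [armSum, armCount, Finset.sum_range_succ, Finset.sum_range_succ, ← armSum, ← armCount]
      split_ifs with h
      · rw [← Real.exp_add]
        congr 1
        push_cast
        ring
      · simp
    have hφm : Measurable fun p : (ℕ → Y × (Fin K → X)) × (Fin K → X) => φ p.1 p.2 := by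
      refine ((hEm t).comp measurable_fst).mul (Measurable.ite ?_ (by fun_prop) measurable_const)
      exact ((measurable_arm hπ t).comp measurable_fst) (measurableSet_singleton j)
    have hφb : ∀ z x, |φ z x| ≤ Real.exp (|l| * (t * A)) * max (Real.exp (|l| * A)) 1 := by
      intro z x
      rw [abs_mul, abs_of_pos (hE0 t z)]
      refine mul_le_mul (hEb t z) ?_ (abs_nonneg _) (Real.exp_pos _).le
      split_ifs
      · rw [abs_of_pos (Real.exp_pos _)]
        refine le_max_of_le_left (Real.exp_le_exp.2 ?_)
        have h1 : l * f (x j) ≤ |l| * A := (le_abs_self _).trans ((abs_mul _ _).trans_le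
          (mul_le_mul_of_nonneg_left (hA _) (abs_nonneg l)))
        linarith
      · simp
    have hdep : ∀ z z' : ℕ → Y × (Fin K → X), (∀ s < t, z s = z' s) → (z t).1 = (z' t).1 →
        φ z = φ z' := fun z z' h ht => by
      funext x
      simp only [φ, E]
      rw [armSum_congr π f j t h, armCount_congr π j t h, arm_congr π t h ht]
    simp_rw [hstep]
    rw [integral_integrate_out_states hZ_meas hZ_indep hZ_law t hφm hφb hdep]
    have hle : ∀ z, ∫ x, φ z x ∂ρ ≤ E t z := fun z => by
      simp only [φ]
      rw [integral_const_mul]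
      refine mul_le_of_le_one_right (hE0 t z).le ?_
      split_ifs
      · exact hoeff
      · simp
    refine integral_mono_of_nonneg (Filter.Eventually.of_forall fun ω => ?_) (hEint t)
      (Filter.Eventually.of_forall fun ω => hle _)
    refine integral_nonneg fun x => mul_nonneg (hE0 _ _).le ?_
    split_ifs
    · exact (Real.exp_pos _).le
    · exact zero_le_one

/-- Hoeffding's inequality for the adaptively many observed states of an arm. -/
theorem measureReal_armSum_ge_le (hZ_meas : ∀ t, Measurable (Z t)) (hZ_indep : iIndepFun Z P)
    (hZ_law : ∀ t, P.map (Z t) = ν.prod ρ) (hπ : π.IsMeasurable) (hf : Measurable f)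
    (hfab : ∀ x, f x ∈ Set.Icc a b) (hf0 : ∫ x, f (x j) ∂ρ = 0) (hab : a < b) {β : ℝ}
    (hβ : 0 ≤ β) (t : ℕ) :
    P.real {ω | 1 ≤ armCount π (fun s => Z s ω) j t ∧
      (b - a) * Real.sqrt (β * armCount π (fun s => Z s ω) j t)
        ≤ armSum π f (fun s => Z s ω) j t} ≤ t * Real.exp (-2 * β) := by
  have hG : 0 < b - a := sub_pos.2 hab
  set G := b - a
  -- The number of pulls is random, so it is fixed to each possible value `s` in turn; the union
  -- over `s ≤ t` costs the factor `t`.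
  let D : ℕ → Set Ω := fun s => {ω | armCount π (fun s => Z s ω) j t = s ∧
    G * Real.sqrt (β * s) ≤ armSum π f (fun s => Z s ω) j t}
  have hsub : {ω | 1 ≤ armCount π (fun s => Z s ω) j t ∧
      G * Real.sqrt (β * armCount π (fun s => Z s ω) j t)
        ≤ armSum π f (fun s => Z s ω) j t} ⊆ ⋃ s ∈ Finset.Icc 1 t, D s := by
    rintro ω ⟨h1, h2⟩
    simp only [Set.mem_iUnion]
    exact ⟨armCount π (fun s => Z s ω) j t,
      Finset.mem_Icc.2 ⟨h1, armCount_le _ _ _ _⟩, rfl, h2⟩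
  have hZm : Measurable fun ω => (fun s => Z s ω) := measurable_pi_lambda _ hZ_meas
  have hD : ∀ s ∈ Finset.Icc 1 t, P.real (D s) ≤ Real.exp (-2 * β) := by
    intro s hs
    have hs0 : (0 : ℝ) < s := by exact_mod_cast (Finset.mem_Icc.1 hs).1
    -- The minimizer of the Chernoff exponent: the linear term becomes `4 * β` and the compensator
    -- `2 * β`, leaving `exp (-2 * β)`.
    set l := 4 * Real.sqrt (β * s) / (s * G) with hl
    have hl0 : 0 ≤ l := by positivity
    have hsq : Real.sqrt (β * s) ^ 2 = β * s := Real.sq_sqrt (by positivity)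
    have hlG : l * (G * Real.sqrt (β * s)) = 4 * β := by
      rw [hl]
      generalize Real.sqrt (β * s) = w at hsq
      field_simp
      linear_combination hsq
    have hlc : s * (l ^ 2 * G ^ 2 / 8) = 2 * β := by
      rw [hl]
      generalize Real.sqrt (β * s) = w at hsq
      field_simp
      linear_combination 16 * hsq
    let E : Ω → ℝ := fun ω => Real.exp (l * armSum π f (fun s => Z s ω) j t
      - armCount π (fun s => Z s ω) j t * (l ^ 2 * G ^ 2 / 8))
    have hE : ∫ ω, E ω ∂P ≤ 1 :=
      integral_exp_armSum_le hZ_meas hZ_indep hZ_law hπ hf hfab hf0 l t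
    have hDE : D s ⊆ {ω | Real.exp (2 * β) ≤ E ω} := by
      rintro ω ⟨h1, h2⟩
      refine Real.exp_le_exp.2 ?_
      rw [h1, hlc]
      have := mul_le_mul_of_nonneg_left h2 hl0
      linarith
    have hEint : Integrable E P := by
      refine Integrable.of_bound (C := Real.exp (l * (t * max |a| |b|))) ?_
        (Filter.Eventually.of_forall fun ω => ?_)
      · have h1 := (measurable_armSum hπ hf j t).comp hZm
        have h3 : Measurable fun ω => (armCount π (fun s => Z s ω) j t : ℝ) :=
          measurable_from_top.comp ((measurable_armCount hπ j t).comp hZm)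
        simp only [Function.comp_def] at h1
        exact Measurable.aestronglyMeasurable (by fun_prop)
      · rw [Real.norm_eq_abs, abs_of_pos (Real.exp_pos _)]
        refine Real.exp_le_exp.2 ?_
        have h1 := mul_le_mul_of_nonneg_left ((le_abs_self _).trans (abs_armSum_le π
          (fun x => abs_le_max_abs_abs (hfab x).1 (hfab x).2) (fun s => Z s ω) j t)) hl0
        have h2 : 0 ≤ (armCount π (fun s => Z s ω) j t : ℝ) * (l ^ 2 * G ^ 2 / 8) := by positivity
        linarith
    have hmk := mul_meas_ge_le_integral_of_nonneg (μ := P) (f := E)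
      (Filter.Eventually.of_forall fun ω => (Real.exp_pos _).le) hEint (Real.exp (2 * β))
    have hmono : P.real (D s) ≤ P.real {ω | Real.exp (2 * β) ≤ E ω} :=
      measureReal_mono hDE
    rw [show -2 * β = -(2 * β) by ring, Real.exp_neg, ← one_div, le_div_iff₀ (Real.exp_pos _)]
    calc P.real (D s) * Real.exp (2 * β) ≤ Real.exp (2 * β) * P.real {ω | Real.exp (2 * β) ≤ E ω} := by
          rw [mul_comm]
          exact mul_le_mul_of_nonneg_left hmono (Real.exp_pos _).le
      _ ≤ 1 := hmk.trans hE
  calc _ ≤ P.real (⋃ s ∈ Finset.Icc 1 t, D s) :=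
        measureReal_mono hsub (measure_ne_top _ _)
    _ ≤ ∑ s ∈ Finset.Icc 1 t, P.real (D s) := measureReal_biUnion_finset_le _ _
    _ ≤ ∑ s ∈ Finset.Icc 1 t, Real.exp (-2 * β) := Finset.sum_le_sum hD
    _ = t * Real.exp (-2 * β) := by simp

end Concentration

/-! ### The algorithm's statistics along a trajectory -/

section Choice

variable {Y : Set ℝ} {X : Type*} {K M : ℕ}

theorem pulls_history (π : Policy Y X K) (z : ℕ → Y × (Fin K → X)) (j : Fin K) (t : ℕ) :
    pulls (fun s : Fin t => (arm π z s, (z s).2 (arm π z s))) j = armCount π z j t := by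
  rw [pulls, armCount, Finset.card_filter,
    ← Fin.sum_univ_eq_sum_range (fun u => if arm π z u = j then 1 else 0)]

theorem sampleMean_history (r : Fin M → X → ℝ) (π : Policy Y X K) (z : ℕ → Y × (Fin K → X))
    (i : Fin M) (j : Fin K) (t : ℕ) :
    sampleMean r (fun s : Fin t => (arm π z s, (z s).2 (arm π z s))) i j
      = armSum π (r i) z j t / armCount π z j t := by
  rw [sampleMean, pulls_history, armSum, Finset.sum_filter,
    ← Fin.sum_univ_eq_sum_range (fun u => if arm π z u = j then r i ((z u).2 j) else 0)]
  congr 1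
  refine Finset.sum_congr rfl fun s _ => ?_
  dsimp only
  split_ifs with h
  · rw [h]
  · rfl

/-- The policy runs DCB(ε) on the contexts `q y`. -/
def RunsDCB (ε : ℝ) (r : Fin M → X → ℝ) (q : Y → Fin M) (π : Policy Y X K) : Prop :=
  ∀ (n : ℕ) (h : Fin n → Y × Fin K × X) (y : Y),
    IsDCBChoice ε r (fun s => (h s).2) (q y) (π n h y)

variable {ε : ℝ} {r : Fin M → X → ℝ} {q : Y → Fin M} {π : Policy Y X K}

theorem RunsDCB.isDCBChoice_arm (h : RunsDCB ε r q π) (z : ℕ → Y × (Fin K → X)) (t : ℕ) :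
    IsDCBChoice ε r (fun s : Fin t => (arm π z s, (z s).2 (arm π z s))) (q (z t).1)
      (arm π z t) := by
  rw [arm_eq π z t]
  exact h t _ _

/-- The initial round pulls arm `j` in the trial with index `j`. Hence later sample means and
confidence radii never divide by zero. -/
theorem RunsDCB.one_le_armCount (h : RunsDCB ε r q π) (z : ℕ → Y × (Fin K → X)) (j : Fin K)
    {t : ℕ} (ht : K ≤ t) : 1 ≤ armCount π z j t := by
  have hj : arm π z j = j := by
    have := h.isDCBChoice_arm z j
    rw [IsDCBChoice, if_pos j.2] at this
    exact Fin.ext this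
  unfold armCount
  calc 1 = if arm π z j = j then 1 else 0 := by rw [if_pos hj]
    _ ≤ _ := Finset.single_le_sum (f := fun u => if arm π z u = j then 1 else 0)
        (fun _ _ => Nat.zero_le _) (Finset.mem_range.2 (j.2.trans_le ht))

theorem mem_Icc_iInf_iSup {f : X → ℝ} {B : ℝ} (hf : ∀ x, |f x| ≤ B) (x : X) :
    f x ∈ Set.Icc (⨅ x', f x') (⨆ x', f x') :=
  ⟨ciInf_le ⟨-B, by rintro _ ⟨x', rfl⟩; exact (abs_le.1 (hf x')).1⟩ x,
    le_ciSup ⟨B, by rintro _ ⟨x', rfl⟩; exact (abs_le.1 (hf x')).2⟩ x⟩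

end Choice

/-! ### Logarithmic regret of DCB(ε) -/

section Regret

variable {Y : Set ℝ} {X : Type*} [MeasurableSpace X] {K M : ℕ} {ε B : ℝ} {r : Fin M → X → ℝ}
  {q : Y → Fin M} {π : Policy Y X K} {ρ : Measure (Fin K → X)}

/-- The expected reward of the arm `j` under the context `i`. -/
noncomputable def armMean (r : Fin M → X → ℝ) (ρ : Measure (Fin K → X)) (i : Fin M)
    (j : Fin K) : ℝ :=
  ∫ x, r i (x j) ∂ρ

/-- The expected loss of the arm `j` under the context `i`. -/
noncomputable def gap (r : Fin M → X → ℝ) (ρ : Measure (Fin K → X)) (i : Fin M)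
    (j : Fin K) : ℝ :=
  (⨆ k, armMean r ρ i k) - armMean r ρ i j

/-- The sample mean of the arm `j` under the context `i` is off by the confidence radius in trial
number `t + 1`. -/
def confidenceFails (ε : ℝ) (r : Fin M → X → ℝ) (ρ : Measure (Fin K → X)) (π : Policy Y X K)
    (i : Fin M) (j : Fin K) (t : ℕ) : Set (ℕ → Y × (Fin K → X)) :=
  {z | 0 < rewardRange r i ∧ 1 ≤ armCount π z j t ∧
    rewardRange r i * Real.sqrt ((2 + ε) * Real.log ((t : ℝ) + 1) * armCount π z j t)
      ≤ |armSum π (fun x => r i x - armMean r ρ i j) z j t|}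

theorem armMean_le_iSup (i : Fin M) (j : Fin K) :
    armMean r ρ i j ≤ ⨆ k, armMean r ρ i k :=
  le_ciSup (Set.finite_range _).bddAbove j

theorem gap_nonneg (i : Fin M) (j : Fin K) : 0 ≤ gap r ρ i j :=
  sub_nonneg.2 (armMean_le_iSup i j)

theorem exists_armMean_eq_iSup (ρ : Measure (Fin K → X)) (i : Fin M) (hK : 0 < K) :
    ∃ k, armMean r ρ i k = ⨆ k, armMean r ρ i k := by
  have : Nonempty (Fin K) := ⟨⟨0, hK⟩⟩
  exact exists_eq_ciSup_of_finite

theorem measurableSet_confidenceFails (hπ : π.IsMeasurable) (hr : ∀ i, Measurable (r i))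
    (i : Fin M) (j : Fin K) (t : ℕ) : MeasurableSet (confidenceFails ε r ρ π i j t) := by
  have h1 := measurable_armCount hπ j t
  have h2 : Measurable fun z : ℕ → Y × (Fin K → X) => (armCount π z j t : ℝ) :=
    measurable_from_top.comp h1
  have h3 := measurable_armSum hπ ((hr i).sub_const (armMean r ρ i j)) j t
  refine (MeasurableSet.const _).inter (MeasurableSet.inter ?_ ?_)
  · exact h1 measurableSet_Ici
  · exact measurableSet_le (by fun_prop) (h3.norm)

variable [IsProbabilityMeasure ρ]

theorem integrable_reward (hr : ∀ i, Measurable (r i)) (hB : ∀ i x, |r i x| ≤ B) (i : Fin M)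
    (j : Fin K) : Integrable (fun x : Fin K → X => r i (x j)) ρ :=
  Integrable.of_bound ((hr i).comp (measurable_pi_apply j)).aestronglyMeasurable B
    (Filter.Eventually.of_forall fun _ => hB i _)

theorem armMean_mem_Icc (hr : ∀ i, Measurable (r i)) (hB : ∀ i x, |r i x| ≤ B) (i : Fin M)
    (j : Fin K) : armMean r ρ i j ∈ Set.Icc (⨅ x, r i x) (⨆ x, r i x) := by
  have hint := integrable_reward (ρ := ρ) hr hB i j
  constructor
  · calc (⨅ x, r i x) = ∫ _ : Fin K → X, (⨅ x, r i x) ∂ρ := by simp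
      _ ≤ _ := integral_mono (integrable_const _) hint fun _ => (mem_Icc_iInf_iSup (hB i) _).1
  · calc armMean r ρ i j ≤ ∫ _ : Fin K → X, (⨆ x, r i x) ∂ρ :=
          integral_mono hint (integrable_const _) fun _ => (mem_Icc_iInf_iSup (hB i) _).2
      _ = _ := by simp

theorem abs_armMean_le (hB : ∀ i x, |r i x| ≤ B) (i : Fin M)
    (j : Fin K) : |armMean r ρ i j| ≤ B := by
  refine (norm_integral_le_of_norm_le_const (f := fun x : Fin K → X => r i (x j)) (C := B)
    (Filter.Eventually.of_forall fun _ => hB i _)).trans ?_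
  simp

/-- All means lie between the infimum and the supremum of the rewards. A positive gap thus forces a
positive range, as `confidenceFails` demands. -/
theorem gap_le_rewardRange (hr : ∀ i, Measurable (r i)) (hB : ∀ i x, |r i x| ≤ B) (i : Fin M)
    (j : Fin K) : gap r ρ i j ≤ rewardRange r i := by
  obtain ⟨k, hk⟩ := exists_armMean_eq_iSup (r := r) ρ i (Fin.pos j)
  rw [gap, rewardRange, ← hk]
  exact sub_le_sub (armMean_mem_Icc hr hB i k).2 (armMean_mem_Icc hr hB i j).1

theorem gap_le_two_mul (hB : ∀ i x, |r i x| ≤ B) (i : Fin M)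
    (j : Fin K) : gap r ρ i j ≤ 2 * B := by
  obtain ⟨k, hk⟩ := exists_armMean_eq_iSup (r := r) ρ i (Fin.pos j)
  rw [gap, ← hk]
  have h1 := (abs_le.1 (abs_armMean_le (ρ := ρ) hB i k)).2
  have h2 := (abs_le.1 (abs_armMean_le (ρ := ρ) hB i j)).1
  linarith

/-- A suboptimal pull after the initial trials is caused by a failed confidence bound or by too
few pulls of the arm. -/
theorem RunsDCB.confidenceFails_or_few_pulls (h : RunsDCB ε r q π) (hε : 0 < ε)
    (hr : ∀ i, Measurable (r i)) (hB : ∀ i x, |r i x| ≤ B) (z : ℕ → Y × (Fin K → X)) {t : ℕ}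
    (ht : K ≤ t) (hgap : 0 < gap r ρ (q (z t).1) (arm π z t)) :
    (∃ j, z ∈ confidenceFails ε r ρ π (q (z t).1) j t) ∨
      (armCount π z (arm π z t) t : ℝ) <
        4 * rewardRange r (q (z t).1) ^ 2 * (2 + ε) / gap r ρ (q (z t).1) (arm π z t) ^ 2
          * Real.log ((t : ℝ) + 1) := by
  have hch := h.isDCBChoice_arm z t
  rw [IsDCBChoice, if_neg (by omega)] at hch
  set i := q (z t).1
  set a := arm π z t with ha
  have hG : 0 < rewardRange r i := hgap.trans_le (gap_le_rewardRange hr hB i a)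
  obtain ⟨k, hk⟩ := exists_armMean_eq_iSup (r := r) ρ i (Fin.pos a)
  refine or_iff_not_imp_left.2 fun hno => ?_
  push Not at hno
  have hβ : 0 ≤ (2 + ε) * Real.log ((t : ℝ) + 1) :=
    mul_nonneg (by linarith) (Real.log_nonneg (by simp))
  set β := (2 + ε) * Real.log ((t : ℝ) + 1) with hβdef
  have hconf : ∀ j, |armSum π (r i) z j t / armCount π z j t - armMean r ρ i j|
      < rewardRange r i * Real.sqrt (β / armCount π z j t) := fun j => by
    have hN1 := h.one_le_armCount z j ht
    have hN : (0 : ℝ) < armCount π z j t := by exact_mod_cast hN1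
    have hj : ¬ (rewardRange r i * Real.sqrt (β * armCount π z j t)
        ≤ |armSum π (fun x => r i x - armMean r ρ i j) z j t|) :=
      fun hle => hno j ⟨hG, hN1, hle⟩
    rw [not_le, armSum_sub_const] at hj
    have h1 : armSum π (r i) z j t / armCount π z j t - armMean r ρ i j
        = (armSum π (r i) z j t - armCount π z j t * armMean r ρ i j) / armCount π z j t := by
      field_simp
    have h2 : Real.sqrt (β / armCount π z j t)
        = Real.sqrt (β * armCount π z j t) / armCount π z j t := by
      rw [← Real.sqrt_sq hN.le, ← Real.sqrt_div' _ (sq_nonneg _), Real.sqrt_sq hN.le]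
      congr 1
      field_simp
    rw [h1, h2, abs_div, abs_of_pos hN, ← mul_div_assoc]
    exact div_lt_div_of_pos_right hj hN
  have hucb : ∀ j, ucbIndex ε r (fun s : Fin t => (arm π z s, (z s).2 (arm π z s))) i j
      = armSum π (r i) z j t / armCount π z j t
        + rewardRange r i * Real.sqrt (β / armCount π z j t) := fun j => by
    rw [ucbIndex, sampleMean_history, pulls_history]
  have h1 := hch k
  rw [hucb, hucb] at h1
  have h2 := abs_lt.1 (hconf k)
  have h3 := abs_lt.1 (hconf a)
  -- Without failures, the best mean is at most the index of `k`, hence at most the index of `a`,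
  -- which exceeds the mean of `a` by less than two radii. Squaring this bound limits the pull
  -- count.
  have hlt : gap r ρ i a < 2 * rewardRange r i * Real.sqrt (β / armCount π z a t) := by
    rw [gap, ← hk]
    linarith
  have hN : (0 : ℝ) < armCount π z a t := by exact_mod_cast h.one_le_armCount z a ht
  have hsq := pow_lt_pow_left₀ hlt hgap.le two_ne_zero
  rw [mul_pow, Real.sq_sqrt (by positivity), mul_div_assoc', lt_div_iff₀ hN] at hsq
  rw [div_mul_eq_mul_div, lt_div_iff₀ (by positivity)]
  rw [hβdef] at hsq
  linarith

/-- Each trial with positive gap costs at most `2 * B` and is charged to the initial round, to a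
failed confidence bound, or to a rarely pulled arm. -/
theorem RunsDCB.sum_gap_le (h : RunsDCB ε r q π) (hε : 0 < ε) (hr : ∀ i, Measurable (r i))
    (hB0 : 0 ≤ B) (hB : ∀ i x, |r i x| ≤ B) (z : ℕ → Y × (Fin K → X)) (T : ℕ) :
    ∑ t ∈ Finset.range T, gap r ρ (q (z t).1) (arm π z t) ≤
      2 * B * (K + ∑ t ∈ Finset.range T, ∑ i, ∑ j,
          (confidenceFails ε r ρ π i j t).indicator (fun _ => (1 : ℝ)) z
        + ∑ i, ∑ j, (4 * rewardRange r i ^ 2 * (2 + ε) / gap r ρ i j ^ 2 * Real.log T + 1)) := by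
  -- For a zero gap the quotient is 0 by the convention on division, so such a pair adds only the
  -- harmless 1.
  let b : Fin M → Fin K → ℝ := fun i j =>
    4 * rewardRange r i ^ 2 * (2 + ε) / gap r ρ i j ^ 2 * Real.log T
  have hb : ∀ i j, 0 ≤ b i j := fun i j =>
    mul_nonneg (by positivity) (Real.log_natCast_nonneg T)
  let F : ℕ → Fin M → Fin K → ℝ := fun t i j =>
    (confidenceFails ε r ρ π i j t).indicator (fun _ => (1 : ℝ)) z
  -- The current context is not required to be `i`: the counter pools all contexts, and dropping
  -- this condition only enlarges the count.
  let W : ℕ → Fin M → Fin K → ℝ := fun t i j =>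
    if arm π z t = j ∧ (armCount π z j t : ℝ) < b i j then 1 else 0
  have hF : ∀ t i j, 0 ≤ F t i j := fun t i j => Set.indicator_nonneg (fun _ _ => zero_le_one) _
  have hW : ∀ t i j, 0 ≤ W t i j := fun t i j => by simp only [W]; split_ifs <;> simp
  have hFs : ∀ t, 0 ≤ ∑ i, ∑ j, F t i j := fun t =>
    Finset.sum_nonneg fun i _ => Finset.sum_nonneg fun j _ => hF t i j
  have hWs : ∀ t, 0 ≤ ∑ i, ∑ j, W t i j := fun t =>
    Finset.sum_nonneg fun i _ => Finset.sum_nonneg fun j _ => hW t i j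
  have hone : ∀ (f : Fin M → Fin K → ℝ), (∀ i j, 0 ≤ f i j) → ∀ i j, f i j ≤ ∑ i, ∑ j, f i j :=
    fun f hf i j => (Finset.single_le_sum (f := fun j => f i j) (fun j _ => hf i j)
      (Finset.mem_univ j)).trans (Finset.single_le_sum (f := fun i => ∑ j, f i j)
        (fun i _ => Finset.sum_nonneg fun j _ => hf i j) (Finset.mem_univ i))
  have hpt : ∀ t ∈ Finset.range T, gap r ρ (q (z t).1) (arm π z t) ≤
      2 * B * ((if t < K then 1 else 0) + ∑ i, ∑ j, F t i j + ∑ i, ∑ j, W t i j) := by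
    intro t htT
    have htT := Finset.mem_range.1 htT
    rcases (gap_nonneg (r := r) (ρ := ρ) (q (z t).1) (arm π z t)).eq_or_lt with h0 | h0
    · rw [← h0]
      have : (0 : ℝ) ≤ if t < K then 1 else 0 := by split_ifs <;> simp
      have := hFs t
      have := hWs t
      positivity
    · refine (gap_le_two_mul hB _ _).trans (le_mul_of_one_le_right (by positivity) ?_)
      by_cases htK : t < K
      · rw [if_pos htK]
        linarith [hFs t, hWs t]
      · rw [if_neg htK]
        rcases h.confidenceFails_or_few_pulls hε hr hB z (not_lt.1 htK) h0 with ⟨j, hj⟩ | hlt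
        · have h1 : F t (q (z t).1) j = 1 := Set.indicator_of_mem hj _
          linarith [hone (F t) (hF t) (q (z t).1) j, hWs t]
        · have h1 : W t (q (z t).1) (arm π z t) = 1 := by
            refine if_pos ⟨rfl, hlt.trans_le ?_⟩
            -- The logarithm at `t + 1` is at most the one at `T`, as `t < T`.
            refine mul_le_mul_of_nonneg_left ?_ (by positivity)
            exact Real.log_le_log (by positivity) (by exact_mod_cast htT)
          linarith [hone (W t) (hW t) (q (z t).1) (arm π z t), hFs t]
  refine (Finset.sum_le_sum hpt).trans ?_
  rw [← Finset.mul_sum, Finset.sum_add_distrib, Finset.sum_add_distrib]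
  refine mul_le_mul_of_nonneg_left ?_ (by positivity)
  have h1 : ∑ t ∈ Finset.range T, (if t < K then (1 : ℝ) else 0) ≤ K := by
    rw [← Finset.sum_filter, Finset.sum_const, nsmul_eq_mul, mul_one]
    have hsub : (Finset.range T).filter (· < K) ⊆ Finset.range K := fun t ht =>
      Finset.mem_range.2 (Finset.mem_filter.1 ht).2
    exact_mod_cast (Finset.card_le_card hsub).trans_eq (Finset.card_range K)
  have h2 : ∑ t ∈ Finset.range T, ∑ i, ∑ j, W t i j ≤ ∑ i, ∑ j, (b i j + 1) := by
    rw [Finset.sum_comm]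
    refine Finset.sum_le_sum fun i _ => ?_
    rw [Finset.sum_comm]
    exact Finset.sum_le_sum fun j _ => card_pulls_of_few_le π z j (hb i j) T
  exact add_le_add (add_le_add h1 le_rfl) h2

variable {Ω : Type*} [MeasurableSpace Ω] {P : Measure Ω} [IsProbabilityMeasure P]
  {ν : Measure Y} [IsProbabilityMeasure ν] {Z : ℕ → Ω → Y × (Fin K → X)}

theorem measureReal_confidenceFails_le (hZ_meas : ∀ t, Measurable (Z t))
    (hZ_indep : iIndepFun Z P) (hZ_law : ∀ t, P.map (Z t) = ν.prod ρ) (hπ : π.IsMeasurable)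
    (hε : 0 < ε) (hr : ∀ i, Measurable (r i)) (hB : ∀ i x, |r i x| ≤ B) (i : Fin M) (j : Fin K)
    (t : ℕ) :
    P.real {ω | (fun s => Z s ω) ∈ confidenceFails ε r ρ π i j t}
      ≤ 2 * (1 / ((t : ℝ) + 1) ^ 2) := by
  -- With a degenerate range the radius is 0 and Hoeffding's inequality says nothing, but then the
  -- failure event is empty by definition.
  by_cases hG : 0 < rewardRange r i
  swap
  · simp only [confidenceFails, hG, false_and, Set.ofPred_false, Set.mem_empty_iff_false,
      measureReal_empty]
    positivity
  set m := armMean r ρ i j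
  have hlog : 0 ≤ Real.log ((t : ℝ) + 1) := Real.log_nonneg (by simp)
  set β := (2 + ε) * Real.log ((t : ℝ) + 1) with hβ
  have hβ0 : 0 ≤ β := by positivity
  have hint := integrable_reward (ρ := ρ) hr hB i j
  have hmI := fun x => mem_Icc_iInf_iSup (hB i) x
  have hup := measureReal_armSum_ge_le (j := j) (f := fun x => r i x - m)
    (a := (⨅ x, r i x) - m) (b := (⨆ x, r i x) - m) hZ_meas hZ_indep hZ_law hπ
    ((hr i).sub_const m)
    (fun x => ⟨sub_le_sub_right (hmI x).1 m, sub_le_sub_right (hmI x).2 m⟩)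
    (by rw [integral_sub hint (integrable_const _)]; simp [m, armMean])
    (sub_lt_sub_right (sub_pos.1 hG) m) hβ0 t
  -- The lower tail is the upper tail of the negated, centered reward, whose range is the same.
  have hlo := measureReal_armSum_ge_le (j := j) (f := fun x => -(r i x - m))
    (a := m - ⨆ x, r i x) (b := m - ⨅ x, r i x) hZ_meas hZ_indep hZ_law hπ
    ((hr i).sub_const m).neg
    (fun x => ⟨by linarith [(hmI x).2], by linarith [(hmI x).1]⟩)
    (by rw [integral_neg, integral_sub hint (integrable_const _)]; simp [m, armMean])
    (sub_lt_sub_left (sub_pos.1 hG) m) hβ0 t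
  have hG1 : (⨆ x, r i x) - m - ((⨅ x, r i x) - m) = rewardRange r i := by
    rw [rewardRange]; ring
  have hG2 : m - (⨅ x, r i x) - (m - ⨆ x, r i x) = rewardRange r i := by
    rw [rewardRange]; ring
  rw [hG1] at hup
  rw [hG2] at hlo
  -- Here `2 * β = (4 + 2 * ε) * log (t + 1)`, so the exponential is at most `(t + 1) ^ (-4)`, which
  -- absorbs the union bound factor `t ≤ (t + 1) ^ 2` and remains summable.
  have htail : t * Real.exp (-2 * β) ≤ 1 / ((t : ℝ) + 1) ^ 2 := by
    have ht : (0 : ℝ) < (t : ℝ) + 1 := by positivity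
    have h1 : Real.exp (-2 * β) ≤ 1 / ((t : ℝ) + 1) ^ 4 := by
      rw [one_div, ← Real.exp_log (pow_pos ht 4), ← Real.exp_neg, Real.log_pow]
      refine Real.exp_le_exp.2 ?_
      rw [hβ]
      push_cast
      nlinarith [mul_nonneg hε.le hlog]
    calc t * Real.exp (-2 * β) ≤ ((t : ℝ) + 1) ^ 2 * (1 / ((t : ℝ) + 1) ^ 4) :=
          mul_le_mul (by nlinarith [(Nat.cast_nonneg t : (0 : ℝ) ≤ t)]) h1 (Real.exp_pos _).le
            (by positivity)
      _ = 1 / ((t : ℝ) + 1) ^ 2 := by field_simp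
  refine (measureReal_mono (fun ω hω => ?_) (measure_ne_top _ _)).trans
    ((measureReal_union_le _ _).trans ((add_le_add hup hlo).trans (by linarith)))
  obtain ⟨-, h1, h2⟩ := hω
  rcases le_abs.1 h2 with h | h
  · exact Or.inl ⟨h1, h⟩
  · exact Or.inr ⟨h1, by rw [armSum_neg]; exact h⟩

/-- The expected regret of DCB(ε) is logarithmic. -/
theorem RunsDCB.integral_sum_gap_le (h : RunsDCB ε r q π) (hπ : π.IsMeasurable)
    (hZ_meas : ∀ t, Measurable (Z t))
    (hZ_indep : iIndepFun Z P) (hZ_law : ∀ t, P.map (Z t) = ν.prod ρ)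
    (hε : 0 < ε) (hr : ∀ i, Measurable (r i))
    (hB0 : 0 ≤ B) (hB : ∀ i x, |r i x| ≤ B) (T : ℕ) :
    ∫ ω, ∑ t ∈ Finset.range T, gap r ρ (q (Z t ω).1) (arm π (fun s => Z s ω) t) ∂P ≤
      2 * B * (K + M * (K * (2 * ∑' t : ℕ, 1 / ((t : ℝ) + 1) ^ 2))
        + ∑ i, ∑ j, (4 * rewardRange r i ^ 2 * (2 + ε) / gap r ρ i j ^ 2 * Real.log T + 1)) := by
  have hZm : Measurable fun ω => (fun s => Z s ω) := measurable_pi_lambda _ hZ_meas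
  let S : Fin M → Fin K → ℕ → Set Ω := fun i j t =>
    {ω | (fun s => Z s ω) ∈ confidenceFails ε r ρ π i j t}
  have hS : ∀ i j t, MeasurableSet (S i j t) := fun i j t =>
    hZm (measurableSet_confidenceFails hπ hr i j t)
  have hint : ∀ i j t, Integrable ((S i j t).indicator fun _ => (1 : ℝ)) P := fun i j t =>
    (integrable_const _).indicator (hS i j t)
  set c := ∑ i, ∑ j, (4 * rewardRange r i ^ 2 * (2 + ε) / gap r ρ i j ^ 2 * Real.log T + 1)
  have hsumint : Integrable (fun ω => ∑ t ∈ Finset.range T, ∑ i, ∑ j,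
      (S i j t).indicator (fun _ => (1 : ℝ)) ω) P :=
    integrable_finsetSum _ fun t _ => integrable_finsetSum _ fun i _ =>
      integrable_finsetSum _ fun j _ => hint i j t
  have hmono : ∫ ω, ∑ t ∈ Finset.range T, gap r ρ (q (Z t ω).1) (arm π (fun s => Z s ω) t) ∂P ≤
      ∫ ω, 2 * B * (K + ∑ t ∈ Finset.range T, ∑ i, ∑ j,
        (S i j t).indicator (fun _ => (1 : ℝ)) ω + c) ∂P := by
    refine integral_mono_of_nonneg (Filter.Eventually.of_forall fun ω =>
      Finset.sum_nonneg fun t _ => gap_nonneg _ _) ?_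
      (Filter.Eventually.of_forall fun ω => h.sum_gap_le hε hr hB0 hB (fun s => Z s ω) T)
    exact (((integrable_const _).add hsumint).add (integrable_const _)).const_mul _
  refine hmono.trans ?_
  rw [integral_const_mul]
  refine mul_le_mul_of_nonneg_left ?_ (by positivity)
  have hKint : Integrable (fun ω => (K : ℝ) + ∑ t ∈ Finset.range T, ∑ i, ∑ j,
      (S i j t).indicator (fun _ => (1 : ℝ)) ω) P := (integrable_const _).add hsumint
  rw [integral_add hKint (integrable_const _),
    integral_add (integrable_const _) hsumint]
  simp only [integral_const, probReal_univ, one_smul]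
  refine add_le_add (add_le_add le_rfl ?_) le_rfl
  rw [integral_finsetSum _ fun t _ => integrable_finsetSum _ fun i _ =>
      integrable_finsetSum _ fun j _ => hint i j t]
  have hsummable : Summable fun t : ℕ => 1 / ((t : ℝ) + 1) ^ 2 := by
    have := (summable_nat_add_iff 1).2 (Real.summable_one_div_nat_pow.2 one_lt_two)
    simpa using this
  calc ∑ t ∈ Finset.range T, ∫ ω, ∑ i, ∑ j, (S i j t).indicator (fun _ => (1 : ℝ)) ω ∂P
      = ∑ t ∈ Finset.range T, ∑ i, ∑ j, P.real (S i j t) := by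
        refine Finset.sum_congr rfl fun t _ => ?_
        rw [integral_finsetSum _ fun i _ => integrable_finsetSum _ fun j _ => hint i j t]
        refine Finset.sum_congr rfl fun i _ => ?_
        rw [integral_finsetSum _ fun j _ => hint i j t]
        refine Finset.sum_congr rfl fun j _ => ?_
        rw [integral_indicator_const _ (hS i j t)]
        simp
    _ ≤ ∑ t ∈ Finset.range T, ∑ _i : Fin M, ∑ _j : Fin K, 2 * (1 / ((t : ℝ) + 1) ^ 2) :=
        Finset.sum_le_sum fun t _ => Finset.sum_le_sum fun i _ => Finset.sum_le_sum fun j _ =>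
          measureReal_confidenceFails_le hZ_meas hZ_indep hZ_law hπ hε hr hB i j t
    _ = M * (K * (2 * ∑ t ∈ Finset.range T, 1 / ((t : ℝ) + 1) ^ 2)) := by
        simp [Finset.mul_sum]
    _ ≤ M * (K * (2 * ∑' t : ℕ, 1 / ((t : ℝ) + 1) ^ 2)) := by
        have := hsummable.sum_le_tsum (Finset.range T) fun t _ => by positivity
        gcongr

end Regret

/-! ### Measurability and error of the quantization -/

namespace IntervalPartition

variable {Y : Set ℝ} {δ : ℝ} {M : ℕ} (Q : IntervalPartition Y δ M)

theorem quantize_eq_iff (y : Y) (i : Fin M) : Q.quantize y = i ↔ (y : ℝ) ∈ Q.cell i := by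
  refine ⟨fun h => h ▸ Q.mem_cell_quantize y, fun h => ?_⟩
  by_contra hne
  exact Set.disjoint_left.1 (Q.disjoint _ _ hne) (Q.mem_cell_quantize y) h

theorem measurable_quantize : Measurable Q.quantize := by
  refine measurable_to_countable' fun i => ?_
  have : Q.quantize ⁻¹' {i} = Subtype.val ⁻¹' Q.cell i := by
    ext y
    exact Q.quantize_eq_iff y i
  rw [this]
  exact measurable_subtype_coe (Q.ordConnected i).measurableSet

/-- The infimum and the supremum of the cell are at most `δ` apart and enclose `y`, so their average
is within half of that. -/
theorem abs_sub_midpoint_le {i : Fin M} {y : ℝ} (hy : y ∈ Q.cell i) :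
    |y - Q.midpoint i| ≤ δ / 2 := by
  have h1 : ∀ z ∈ Q.cell i, y - δ ≤ z := fun z hz => by
    have := (abs_le.1 (Q.size_le i z hz y hy)).1; linarith
  have h2 : ∀ z ∈ Q.cell i, z ≤ y + δ := fun z hz => by
    have := (abs_le.1 (Q.size_le i z hz y hy)).2; linarith
  have hI : sInf (Q.cell i) ≤ y := csInf_le ⟨_, h1⟩ hy
  have hS : y ≤ sSup (Q.cell i) := le_csSup ⟨_, h2⟩ hy
  have hd : sSup (Q.cell i) ≤ sInf (Q.cell i) + δ := by
    refine csSup_le ⟨y, hy⟩ fun u hu => ?_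
    rw [← sub_le_iff_le_add]
    refine le_csInf ⟨y, hy⟩ fun v hv => ?_
    have := (abs_le.1 (Q.size_le i u hu v hv)).2
    linarith
  unfold midpoint
  rw [abs_le]
  constructor <;> linarith

theorem abs_sub_center_quantize_le (y : Y) : |(y : ℝ) - (Q.center (Q.quantize y) : ℝ)| ≤ δ / 2 :=
  Q.abs_sub_midpoint_le (Q.mem_cell_quantize y)

end IntervalPartition

/-! ### From continuous contexts to the discretized problem -/

section Reduction

variable {Y : Set ℝ} {X : Type*} [MeasurableSpace X] {K M : ℕ} {g : Y → X → ℝ} {L B : ℝ}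
  {r : Fin M → X → ℝ} {q : Y → Fin M}

/-- A Carathéodory function, continuous in the context and measurable in the state, is jointly
measurable. -/
theorem measurable_uncurry_of_lipschitz (hg_meas : ∀ y : Y, Measurable (g y))
    (hg_lip : ∀ (y y' : Y) (x : X), |g y x - g y' x| ≤ L * |(y : ℝ) - (y' : ℝ)|) :
    Measurable (Function.uncurry g) := by
  refine measurable_uncurry_of_continuous_of_measurable (fun x => ?_) hg_meas
  refine (LipschitzWith.of_dist_le_mul (K := L.toNNReal) fun y y' => ?_).continuous
  rw [Real.dist_eq, Subtype.dist_eq, Real.dist_eq]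
  exact (hg_lip y y' x).trans (mul_le_mul_of_nonneg_right (Real.le_coe_toNNReal L) (abs_nonneg _))

theorem measurable_uncurry_discretized (hr : ∀ i, Measurable (r i)) :
    Measurable fun p : Fin M × X => r p.1 p.2 :=
  measurable_from_prod_countable_right hr

theorem integrable_iSup_armMean {ρ : Measure (Fin K → X)} {Ω' : Type*} [MeasurableSpace Ω'] {μ : Measure Ω'}
    [IsFiniteMeasure μ] {f : Ω' → Fin M} (hf : Measurable f) :
    Integrable (fun ω => ⨆ k, armMean r ρ (f ω) k) μ :=
  (Integrable.of_finite (μ := μ.map f) (f := fun i => ⨆ k, armMean r ρ i k)).comp_measurable hf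

variable {ν : Measure Y} [IsProbabilityMeasure ν] {ρ : Measure (Fin K → X)}
  [IsProbabilityMeasure ρ] {Ω : Type*} [MeasurableSpace Ω] {P : Measure Ω}
  [IsProbabilityMeasure P] {Z : ℕ → Ω → Y × (Fin K → X)} {π : Policy Y X K}

/-- No hypothesis beats the best arms of the discretized problem by more than the
discretization error. -/
theorem expectedReward_le (hg : Measurable (Function.uncurry g))
    (hgB : ∀ (y : Y) (x : X), |g y x| ≤ B) (hr : ∀ i, Measurable (r i))
    (hB : ∀ i x, |r i x| ≤ B) (hq : Measurable q) {η : ℝ}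
    (hη : ∀ y x, |g y x - r (q y) x| ≤ η) {h : Y → Fin K} (hh : Measurable h) :
    expectedReward g (ν.prod ρ) h ≤ ∫ y, (⨆ k, armMean r ρ (q y) k) ∂ν + η := by
  have hsel : Measurable fun z : Y × (Fin K → X) => z.2 (h z.1) :=
    measurable_eval_arm.comp (measurable_snd.prodMk (hh.comp measurable_fst))
  have hgint : Integrable (fun z : Y × (Fin K → X) => g z.1 (z.2 (h z.1))) (ν.prod ρ) :=
    Integrable.of_bound (hg.comp (measurable_fst.prodMk hsel)).aestronglyMeasurable B
      (Filter.Eventually.of_forall fun _ => hgB _ _)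
  have hrint : Integrable (fun z : Y × (Fin K → X) => r (q z.1) (z.2 (h z.1))) (ν.prod ρ) :=
    Integrable.of_bound ((measurable_uncurry_discretized hr).comp
      ((hq.comp measurable_fst).prodMk hsel)).aestronglyMeasurable B
      (Filter.Eventually.of_forall fun _ => hB _ _)
  calc expectedReward g (ν.prod ρ) h
      ≤ ∫ z, (r (q z.1) (z.2 (h z.1)) + η) ∂(ν.prod ρ) :=
        integral_mono hgint (hrint.add (integrable_const _)) fun z => by
          have := (abs_le.1 (hη z.1 (z.2 (h z.1)))).2
          dsimp only
          linarith
    _ = ∫ y, armMean r ρ (q y) (h y) ∂ν + η := by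
        rw [integral_add hrint (integrable_const _), integral_prod _ hrint]
        simp [armMean]
    _ ≤ ∫ y, (⨆ k, armMean r ρ (q y) k) ∂ν + η := by
        refine add_le_add (integral_mono ?_ (integrable_iSup_armMean hq)
          fun y => armMean_le_iSup _ _) le_rfl
        exact (Integrable.of_finite (μ := ν.map fun y => (q y, h y))
          (f := fun p : Fin M × Fin K => armMean r ρ p.1 p.2)).comp_measurable (hq.prodMk hh)

/-- The expected reward of one trial, compared with the best arms of the discretized problem. -/
theorem le_integral_reward_arm (hZ_meas : ∀ t, Measurable (Z t)) (hZ_indep : iIndepFun Z P)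
    (hZ_law : ∀ t, P.map (Z t) = ν.prod ρ) (hπ : π.IsMeasurable)
    (hg : Measurable (Function.uncurry g))
    (hgB : ∀ (y : Y) (x : X), |g y x| ≤ B) (hr : ∀ i, Measurable (r i))
    (hB : ∀ i x, |r i x| ≤ B) (hq : Measurable q) {η : ℝ}
    (hη : ∀ y x, |g y x - r (q y) x| ≤ η) (t : ℕ) :
    ∫ y, (⨆ k, armMean r ρ (q y) k) ∂ν
        - ∫ ω, gap r ρ (q (Z t ω).1) (arm π (fun s => Z s ω) t) ∂P - η ≤
      ∫ ω, g (Z t ω).1 ((Z t ω).2 (arm π (fun s => Z s ω) t)) ∂P := by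
  have hZm : Measurable fun ω => (fun s => Z s ω) := measurable_pi_lambda _ hZ_meas
  have ha : Measurable fun ω => arm π (fun s => Z s ω) t := (measurable_arm hπ t).comp hZm
  have hsel : Measurable fun ω => (Z t ω).2 (arm π (fun s => Z s ω) t) :=
    measurable_eval_arm.comp ((hZ_meas t).snd.prodMk ha)
  have hqZ : Measurable fun ω => q (Z t ω).1 := hq.comp (hZ_meas t).fst
  have hgint : Integrable (fun ω => g (Z t ω).1 ((Z t ω).2 (arm π (fun s => Z s ω) t))) P :=
    Integrable.of_bound (hg.comp ((hZ_meas t).fst.prodMk hsel)).aestronglyMeasurable B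
      (Filter.Eventually.of_forall fun _ => hgB _ _)
  have hrint : Integrable
      (fun ω => r (q (Z t ω).1) ((Z t ω).2 (arm π (fun s => Z s ω) t))) P :=
    Integrable.of_bound ((measurable_uncurry_discretized hr).comp
      (hqZ.prodMk hsel)).aestronglyMeasurable B (Filter.Eventually.of_forall fun _ => hB _ _)
  have hgap : Integrable (fun ω => gap r ρ (q (Z t ω).1) (arm π (fun s => Z s ω) t)) P :=
    (Integrable.of_finite (μ := P.map fun ω => (q (Z t ω).1, arm π (fun s => Z s ω) t))
      (f := fun p : Fin M × Fin K => gap r ρ p.1 p.2)).comp_measurable (hqZ.prodMk ha)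
  have hbest : ∫ y, (⨆ k, armMean r ρ (q y) k) ∂ν
      = ∫ ω, (⨆ k, armMean r ρ (q (Z t ω).1) k) ∂P := by
    have hlaw : P.map (fun ω => (Z t ω).1) = ν := by
      have := congrArg (Measure.map Prod.fst) (hZ_law t)
      rw [Measure.map_map measurable_fst (hZ_meas t), Measure.map_fst_prod] at this
      simpa [Function.comp_def] using this
    have hm : Measurable fun y => ⨆ k, armMean r ρ (q y) k :=
      (Measurable.of_discrete (f := fun i => ⨆ k, armMean r ρ i k)).comp hq
    nth_rewrite 1 [← hlaw]
    exact integral_map (hZ_meas t).fst.aemeasurable hm.aestronglyMeasurable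
  -- The arm is fixed by the past and the current context, so averaging over the fresh states turns
  -- the reward into the mean of that arm.
  have hmean : ∫ ω, r (q (Z t ω).1) ((Z t ω).2 (arm π (fun s => Z s ω) t)) ∂P
      = ∫ ω, armMean r ρ (q (Z t ω).1) (arm π (fun s => Z s ω) t) ∂P :=
    integral_integrate_out_states (φ := fun z x => r (q (z t).1) (x (arm π z t)))
      hZ_meas hZ_indep hZ_law t
      ((measurable_uncurry_discretized hr).comp
        ((hq.comp ((measurable_pi_apply t).comp measurable_fst).fst).prodMk
          (measurable_eval_arm.comp
            (measurable_snd.prodMk ((measurable_arm hπ t).comp measurable_fst)))))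
      (fun z x => hB _ _)
      (fun z z' h ht => by funext x; simp only [ht, arm_congr π t h ht])
  calc _ = ∫ ω, armMean r ρ (q (Z t ω).1) (arm π (fun s => Z s ω) t) ∂P - η := by
        rw [hbest, ← integral_sub (integrable_iSup_armMean hqZ) hgap]
        simp [gap]
    _ = ∫ ω, (r (q (Z t ω).1) ((Z t ω).2 (arm π (fun s => Z s ω) t)) - η) ∂P := by
        rw [integral_sub hrint (integrable_const _), hmean]
        simp
    _ ≤ _ := integral_mono (hrint.sub (integrable_const _)) hgint fun ω => by
        have := (abs_le.1 (hη (Z t ω).1 ((Z t ω).2 (arm π (fun s => Z s ω) t)))).1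
        dsimp only
        linarith

/-- The expected regret is at most that of the discretized problem plus the discretization
errors. -/
theorem regret_le_sum_gap (hZ_meas : ∀ t, Measurable (Z t)) (hZ_indep : iIndepFun Z P)
    (hZ_law : ∀ t, P.map (Z t) = ν.prod ρ) (hπ : π.IsMeasurable)
    (hg : Measurable (Function.uncurry g))
    (hgB : ∀ (y : Y) (x : X), |g y x| ≤ B) (hr : ∀ i, Measurable (r i))
    (hB : ∀ i x, |r i x| ≤ B) (hq : Measurable q) {η : ℝ}
    (hη : ∀ y x, |g y x - r (q y) x| ≤ η) {h : Y → Fin K} (hh : Measurable h) (T : ℕ) :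
    regret g (ν.prod ρ) h P Z π T ≤ 2 * η * T +
      ∫ ω, ∑ t ∈ Finset.range T, gap r ρ (q (Z t ω).1) (arm π (fun s => Z s ω) t) ∂P := by
  have hZm : Measurable fun ω => (fun s => Z s ω) := measurable_pi_lambda _ hZ_meas
  have ha : ∀ t, Measurable fun ω => arm π (fun s => Z s ω) t :=
    fun t => (measurable_arm hπ t).comp hZm
  have hgint : ∀ t, Integrable
      (fun ω => g (Z t ω).1 ((Z t ω).2 (arm π (fun s => Z s ω) t))) P := fun t =>
    Integrable.of_bound (hg.comp ((hZ_meas t).fst.prodMk (measurable_eval_arm.comp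
      ((hZ_meas t).snd.prodMk (ha t))))).aestronglyMeasurable B
      (Filter.Eventually.of_forall fun _ => hgB _ _)
  have hgap : ∀ t, Integrable
      (fun ω => gap r ρ (q (Z t ω).1) (arm π (fun s => Z s ω) t)) P := fun t =>
    (Integrable.of_finite (μ := P.map fun ω => (q (Z t ω).1, arm π (fun s => Z s ω) t))
      (f := fun p : Fin M × Fin K => gap r ρ p.1 p.2)).comp_measurable
        ((hq.comp (hZ_meas t).fst).prodMk (ha t))
  rw [regret, integral_finsetSum _ fun t _ => hgint t, integral_finsetSum _ fun t _ => hgap t]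
  -- The error `η` enters once here and once in each term of `hsum`, hence `2 * η` per trial.
  have hR := expectedReward_le (ν := ν) (ρ := ρ) hg hgB hr hB hq hη hh
  have hsum := Finset.sum_le_sum fun t (_ : t ∈ Finset.range T) =>
    le_integral_reward_arm hZ_meas hZ_indep hZ_law hπ hg hgB hr hB hq hη t
  simp only [Finset.sum_sub_distrib, Finset.sum_const, Finset.card_range, nsmul_eq_mul] at hsum
  have hTR := mul_le_mul_of_nonneg_left hR (Nat.cast_nonneg (α := ℝ) T)
  linarith

end Reduction

end CCB

/-! ### Assembly of the final bound -/

theorem theorem4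
    {Ω : Type*} [MeasurableSpace Ω] (P : Measure Ω) [IsProbabilityMeasure P]
    {X : Type*} [MeasurableSpace X]
    (Y : Set ℝ) (K : ℕ) (hK : 0 < K)
    -- the known reward function: bounded, and `L`-Lipschitz in the context
    (g : Y → X → ℝ) (hg_meas : ∀ y : Y, Measurable (g y))
    (B : ℝ) (hB : 0 < B) (hg_bdd : ∀ (y : Y) (x : X), |g y x| ≤ B)
    (L : ℝ) (hL : 0 ≤ L)
    (hg_lip : ∀ (y y' : Y) (x : X), |g y x - g y' x| ≤ L * |(y : ℝ) - (y' : ℝ)|)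
    -- the laws of the context and of the vector of arm states, and the i.i.d. trials
    (ν : Measure Y) [IsProbabilityMeasure ν]
    (ρ : Measure (Fin K → X)) [IsProbabilityMeasure ρ]
    (Z : ℕ → Ω → Y × (Fin K → X)) (hZ_meas : ∀ t, Measurable (Z t))
    (hZ_indep : iIndepFun Z P) (hZ_law : ∀ t, P.map (Z t) = ν.prod ρ)
    -- the parameters of the algorithm and the partition of the context space
    (ε δ : ℝ) (hε : 0 < ε) (hδ : 0 < δ)
    (M : ℕ) (Q : CCB.IntervalPartition Y δ M) :
    ∃ C : ℝ, ∀ π : CCB.Policy Y X K, π.IsMeasurable → CCB.IsCCB ε g Q π →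
      ∀ hstar : Y → Fin K, CCB.IsBayesOptimal g (ν.prod ρ) hstar →
        ∀ T : ℕ, 2 ≤ T →
          CCB.regret g (ν.prod ρ) hstar P Z π T ≤ δ * L * T + C * Real.log T := by
  let r : Fin M → X → ℝ := fun i x => g (Q.center i) x
  let S : ℝ := ∑' t : ℕ, 1 / ((t : ℝ) + 1) ^ 2
  let D₁ : ℝ := 2 * B * (K + M * (K * (2 * S)) + M * K)
  let D₂ : ℝ := 2 * B * ∑ i, ∑ j, 4 * CCB.rewardRange r i ^ 2 * (2 + ε) / CCB.gap r ρ i j ^ 2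
  -- `D₁` collects the terms free of `T` and is absorbed by `log T ≥ log 2`. Neither constant
  -- involves the policy, so the bound is uniform in the tie-breaking.
  refine ⟨D₁ / Real.log 2 + D₂, fun π hπ hccb hstar hopt T hT => ?_⟩
  have hr : ∀ i, Measurable (r i) := fun i => hg_meas _
  have hrB : ∀ i x, |r i x| ≤ B := fun i x => hg_bdd _ x
  have hη : ∀ y x, |g y x - r (Q.quantize y) x| ≤ L * (δ / 2) := fun y x =>
    (hg_lip _ _ x).trans (mul_le_mul_of_nonneg_left (Q.abs_sub_center_quantize_le y) hL)
  have hdcb : CCB.RunsDCB ε r Q.quantize π := hccb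
  have h1 := CCB.regret_le_sum_gap hZ_meas hZ_indep hZ_law hπ
    (CCB.measurable_uncurry_of_lipschitz hg_meas hg_lip) hg_bdd hr hrB Q.measurable_quantize hη
    hopt.1 T
  have h2 := hdcb.integral_sum_gap_le hπ hZ_meas hZ_indep hZ_law hε hr hB.le hrB T
  have hS : 0 ≤ S := tsum_nonneg fun t => by positivity
  have hlog2 : 0 < Real.log 2 := Real.log_pos one_lt_two
  have hlog : Real.log 2 ≤ Real.log T := Real.log_le_log two_pos (by exact_mod_cast hT)
  have hD₁ : D₁ ≤ D₁ / Real.log 2 * Real.log T := by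
    rw [div_mul_eq_mul_div, le_div_iff₀ hlog2]
    exact mul_le_mul_of_nonneg_left hlog (by positivity)
  have hsplit : 2 * B * (K + M * (K * (2 * S)) + ∑ i, ∑ j, (4 * CCB.rewardRange r i ^ 2 * (2 + ε)
      / CCB.gap r ρ i j ^ 2 * Real.log T + 1)) = D₁ + D₂ * Real.log T := by
    simp only [D₁, D₂, Finset.sum_add_distrib, Finset.sum_const, Finset.card_univ,
      Fintype.card_fin, nsmul_eq_mul, mul_one, ← Finset.sum_mul]
    ring
  rw [hsplit] at h2
  linarith
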